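/- Let $K$ be a pathwise connected poset. A 1-simplex $b=(|b|;\partial_0b,\partial_1b)$ of $K$ consists of elements with $\partial_0b,\partial_1b\le|b|$. A path $p:a\to o$ is a non-empty sequence $b_n*\cdots*b_1$ of 1-simplices with $\partial_1b_1=a$, $\partial_0b_n=o$, $\partial_1b_{i+1}=\partial_0b_i$. Homotopy $\sim$ is the equivalence relation on paths, stable under concatenation, that is generated by replacing a 1-simplex $b_1:x\to z$ by $b_0*b_2$, for 1-simplices $b_2:x\to y$, $b_0:y\to z$ such that the supports of $b_0,b_1,b_2$ have a common upper bound in $K$. Fix $a\in K$ and let $\Pi=\pi_1^a(K)$ be the group of homotopy classes of loops $p:a\to a$. Let $(\mathcal A,\jmath)_K$ be a net of graded complex $*$-algebras (not necessarily unital): $*$-algebras $\mathcal A_o$, $o\in K$, $*$-monomorphisms $\jmath_{o'o}:\mathcal A_o\to\mathcal A_{o'}$ for $o\le o'$ with $\jmath_{o''o}=\jmath_{o''o'}\jmath_{o'o}$, and $*$-morphisms $\beta_o:\mathcal A_o\to\mathcal A_o$ with $\beta_o^2=1$ and $\beta_{o'}\jmath_{o'o}=\jmath_{o'o}\beta_o$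 (the case $\beta=1$ is allowed). Let $A$ be the fibre over $a$ of its enveloping net bundle, that is, the $*$-algebra generated by the pairs $(p,t)$, with $p:o\to a$ a path, $t\in\mathcal A_o$, $o\in K$, subject to $$(p,t)+\lambda(p,t')=(p,t+\lambda t'),\quad (p,t)(p,t')=(p,tt'),\quad (p,t)^*=(p,t^*),$$ $$(p*(o';o',o),t)=(p,\jmath_{o'o}(t))\ \ (o\le o'),\qquad (p,t)=(p',t)\ \text{ if } p\sim p'.$$ It carries the $\Pi$-action $[g](p,t)=(g*p,t)$ and the grading $\beta(p,t)=(p,\beta_o(t))$. In what follows a grading of a Hilbert space is a unitary $\Gamma$ with $\Gamma^2=1$, and $\operatorname{ad}V(T)=VTV^*$, with the domain of $VTV^*$ equal to $V(\operatorname{Dom}T)$. For a selfadjoint operator $D$ (not necessarily bounded), $\operatorname{Dom}(\delta)$ is the set of bounded $t$ such that $\operatorname{ad}\Gamma(t)\,D\subset Dt-b$ for some bounded $b$. Representations are $*$-morphisms into the bounded operators. * ${\rm ncg}(\mathcal A,\jmath)_K$ has as objects the even $\theta$-summable nets of spectral triples $(\mathcal H,U,\Gamma,D,\pi)$: Hilbert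 spaces $\mathcal H_o$ and unitaries $U_{o'o}:\mathcal H_o\to\mathcal H_{o'}$ ($o\le o'$) with $U_{o''o}=U_{o''o'}U_{o'o}$; gradings $\Gamma_o$ of $\mathcal H_o$ with $\Gamma_{o'}U_{o'o}=U_{o'o}\Gamma_o$; representations $\pi_o$ of $\mathcal A_o$ on $\mathcal H_o$ with $\operatorname{ad}U_{o'o}\circ\pi_o=\pi_{o'}\circ\jmath_{o'o}$ and $\operatorname{ad}\Gamma_o\circ\pi_o=\pi_o\circ\beta_o$; selfadjoint, odd ($\operatorname{ad}\Gamma_o(D_o)=-D_o$) operators $D_o$ with $\operatorname{ad}U_{o'o}(D_o)=D_{o'}$, ${\rm Tr}(e^{-s D_o^2})<\infty$ for all real $s>0$, and $\pi_o(\mathcal A_o)\subseteq\operatorname{Dom}(\delta_o)$. Its arrows are the families of unitaries $V_o:\mathcal H_o\to\mathcal H'_o$ with $V_{o'}U_{o'o}=U'_{o'o}V_o$, $V_o\Gamma_o=\Gamma'_oV_o$, $\operatorname{ad}V_o\circ\pi_o=\pi'_o$, $\operatorname{ad}V_o(D_o)=D'_o$. * ${\rm ncg}_\Pi(A)$ has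 as objects the $\Pi$-equivariant even $\theta$-summable spectral triples $(H,\Gamma,D,\pi,u)$: a Hilbert space $H$ with a grading $\Gamma$; a unitary representation $u$ of $\Pi$ on $H$ commuting with $\Gamma$; a representation $\pi$ of $A$ on $H$ with $\operatorname{ad}\Gamma\circ\pi=\pi\circ\beta$ and $\pi(gt)=u_g\pi(t)u_g^*$; a selfadjoint, odd operator $D$ with $\operatorname{ad}u_g(D)=D$, ${\rm Tr}(e^{-s D^2})<\infty$ for all real $s>0$, and $\pi(A)\subseteq\operatorname{Dom}(\delta)$. Its arrows are the unitaries $V:H\to H'$ with $Vu_g=u'_gV$, $V\Gamma=\Gamma'V$, $\operatorname{ad}V\circ\pi=\pi'$, $\operatorname{ad}V(D)=D'$. Then the categories ${\rm ncg}(\mathcal A,\jmath)_K$ and ${\rm ncg}_\Pi(A)$ are equivalent. The equivalence can be chosen so that, up to natural unitary isomorphism, it sends $(\mathcal H,U,\Gamma,D,\pi)$ to $(\mathcal H_a,\Gamma_a,D_a,\pi_*,U_*)$, where $\pi_*(p,t)=U_p\pi_o(t)U_p^*$ for $p:o\to a$ and $t\in\mathcal A_o$, and $U_{*,[p]}=U_p$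 for loops $p:a\to a$, and it sends an arrow $V$ to $V_a$. Here $U_p=U_{b_n}\cdots U_{b_1}$ for $p=b_n*\cdots*b_1$, with $U_b=U_{|b|\,\partial_0b}^{-1}U_{|b|\,\partial_1b}$. -/

import Mathlib

universe u v w

namespace NetSpectral

open Filter Topology
open scoped NNReal ENNReal

/-! Paths and the fundamental group of a poset -/

section Homotopy

variable {K : Type u} [PartialOrder K]

/-- A 1-simplex `(|b|; o, a)` of the poset `K` with 1-face `a`, 0-face `o` and support `|b|`;
it is thought of as a segment from `a` to `o`. -/
structure Simplex1 (a o : K) : Type u where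
  supp : K
  le_left : a ≤ supp
  le_right : o ≤ supp

/-- The opposite 1-simplex. -/
def Simplex1.opp {a o : K} (b : Simplex1 a o) : Simplex1 o a :=
  ⟨b.supp, b.le_right, b.le_left⟩

/-- The 1-simplex `(o'; o', o)` attached to an inclusion `o ≤ o'`. -/
def Simplex1.ofLE {o o' : K} (h : o ≤ o') : Simplex1 o o' := ⟨o', h, le_rfl⟩

/-- Paths `p : a → o`, i.e. nonempty finite sequences `b_n * ⋯ * b_1` of composable 1-simplices;
`step b p` is `b * p`. -/
inductive PosetPath (a : K) : K → Type u
  | single {o : K} (b : Simplex1 a o) : PosetPath a o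
  | step {o o' : K} (b : Simplex1 o o') (p : PosetPath a o) : PosetPath a o'

namespace PosetPath

/-- Concatenation `q * p` (first `p`, then `q`). -/
def comp {a o : K} : {o' : K} → PosetPath o o' → PosetPath a o → PosetPath a o'
  | _, single b, p => step b p
  | _, step b q, p => step b (comp q p)

/-- The opposite path. -/
def opp {a : K} : {o : K} → PosetPath a o → PosetPath o a
  | _, single b => single b.opp
  | _, step b p => comp (opp p) (single b.opp)

/-- The trivial path `(a; a, a)`. -/
def triv (a : K) : PosetPath a a := single (Simplex1.ofLE le_rfl)

/-- Homotopy of paths: the equivalence relation, stable under concatenation, generated by the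
elementary deformations `∂₁c ~ ∂₀c * ∂₂c`, where `c` is a 2-simplex, i.e. a triangle of
1-simplices together with a support `s` that dominates the supports of the three sides. -/
inductive Homotopic : {a o : K} → PosetPath a o → PosetPath a o → Prop
  | deform {x y z : K} (b₂ : Simplex1 x y) (b₀ : Simplex1 y z) (b₁ : Simplex1 x z) (s : K)
      (h₀ : b₀.supp ≤ s) (h₁ : b₁.supp ≤ s) (h₂ : b₂.supp ≤ s) :
      Homotopic (single b₁) (step b₀ (single b₂))
  | comp {x y z : K} {q q' : PosetPath y z} {p p' : PosetPath x y} :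
      Homotopic q q' → Homotopic p p' → Homotopic (q.comp p) (q'.comp p')
  | refl {x y : K} (p : PosetPath x y) : Homotopic p p
  | symm {x y : K} {p q : PosetPath x y} : Homotopic p q → Homotopic q p
  | trans {x y : K} {p q r : PosetPath x y} : Homotopic p q → Homotopic q r → Homotopic p r

theorem comp_assoc {x y z t : K} (r : PosetPath z t) (q : PosetPath y z) (p : PosetPath x y) :
    (r.comp q).comp p = r.comp (q.comp p) := by
  induction r with
  | single b => rfl
  | step b r ih => simp only [comp, ih]

theorem opp_comp {x y z : K} (q : PosetPath y z) (p : PosetPath x y) :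
    (q.comp p).opp = p.opp.comp q.opp := by
  induction q with
  | single b => rfl
  | step b q ih => simp only [comp, opp, ih, comp_assoc]

theorem Homotopic.opp {x y : K} {p q : PosetPath x y} (h : Homotopic p q) :
    Homotopic p.opp q.opp := by
  induction h with
  | deform b₂ b₀ b₁ s h₀ h₁ h₂ => exact .deform b₀.opp b₂.opp b₁.opp s h₂ h₁ h₀
  | comp _ _ ih₁ ih₂ => rw [opp_comp, opp_comp]; exact ih₂.comp ih₁
  | refl p => exact .refl _
  | symm _ ih => exact ih.symm
  | trans _ _ ih₁ ih₂ => exact ih₁.trans ih₂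

theorem triv_comp {x y : K} (p : PosetPath x y) : Homotopic ((triv y).comp p) p := by
  have key {o y : K} (b : Simplex1 o y) :
      Homotopic (step (Simplex1.ofLE (le_refl y)) (single b)) (single b) :=
    (Homotopic.deform b (Simplex1.ofLE le_rfl) b b.supp b.le_right le_rfl le_rfl).symm
  cases p with
  | single b => exact key b
  | step b q => exact (key b).comp (.refl q)

theorem opp_comp_self {x y : K} (p : PosetPath x y) : Homotopic (p.opp.comp p) (triv x) := by
  have key {o y : K} (b : Simplex1 o y) :
      Homotopic (step b.opp (single b)) (triv o) :=
    (Homotopic.deform b b.opp (Simplex1.ofLE le_rfl) b.supp le_rfl b.le_left le_rfl).symm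
  induction p with
  | single b => exact key b
  | step b q ih =>
    have h : (step b q).opp.comp (step b q) = q.opp.comp ((step b.opp (single b)).comp q) := by
      simp only [opp, comp_assoc, comp]
    rw [h]
    exact ((Homotopic.refl _).comp (((key b).comp (.refl q)).trans (triv_comp q))).trans ih

/-- Homotopy, as a setoid on the paths with given endpoints. -/
instance homotopySetoid (a o : K) : Setoid (PosetPath a o) :=
  ⟨Homotopic, Homotopic.refl, Homotopic.symm, Homotopic.trans⟩

end PosetPath

/-- The poset `K` is pathwise connected. -/
def PathwiseConnected (K : Type u) [PartialOrder K] : Prop :=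
  ∀ a o : K, Nonempty (PosetPath a o)

/-- The homotopy group `π₁ᵃ(K)` of loops over `a` modulo homotopy. -/
def HomotopyGroup (a : K) : Type u := Quotient (PosetPath.homotopySetoid a a)

/-- The class `[p]` of a loop `p`. -/
def HomotopyGroup.mk {a : K} (p : PosetPath a a) : HomotopyGroup a := Quotient.mk _ p

/-- The product is `[q] [p] = [q * p]`. -/
instance (a : K) : Group (HomotopyGroup a) :=
  letI : Mul (HomotopyGroup a) :=
    ⟨Quotient.map₂ (fun q p => q.comp p) fun _ _ h _ _ h' => PosetPath.Homotopic.comp h h'⟩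
  letI : One (HomotopyGroup a) := ⟨HomotopyGroup.mk (PosetPath.triv a)⟩
  letI : Inv (HomotopyGroup a) := ⟨Quotient.map PosetPath.opp fun _ _ h => h.opp⟩
  Group.ofLeftAxioms
    (by
      rintro ⟨r⟩ ⟨q⟩ ⟨p⟩
      exact congrArg HomotopyGroup.mk (PosetPath.comp_assoc r q p))
    (by
      rintro ⟨p⟩
      exact Quotient.sound (PosetPath.triv_comp p))
    (by
      rintro ⟨p⟩
      exact Quotient.sound (PosetPath.opp_comp_self p))

end Homotopy

/-! Nets of graded *-algebras -/

/-- A net of graded (complex, not necessarily unital) *-algebras over `K`: *-algebras `A o`,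
*-monomorphisms `j h : A o → A o'` for `h : o ≤ o'` with `j_{o''o} = j_{o''o'} ∘ j_{o'o}`, and a
grading, i.e. an automorphism `β` of the net with `β² = 1` (an ungraded net has `β = 1`). -/
structure GradedNet (K : Type u) [PartialOrder K] where
  A : K → Type v
  [ring : ∀ o, NonUnitalRing (A o)]
  [starRing : ∀ o, StarRing (A o)]
  [module : ∀ o, Module ℂ (A o)]
  [scalarTower : ∀ o, IsScalarTower ℂ (A o) (A o)]
  [smulComm : ∀ o, SMulCommClass ℂ (A o) (A o)]
  [starModule : ∀ o, StarModule ℂ (A o)]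
  j : ∀ {o o' : K}, o ≤ o' → (A o →⋆ₙₐ[ℂ] A o')
  j_injective : ∀ {o o' : K} (h : o ≤ o'), Function.Injective (j h)
  j_comp : ∀ {o o' o'' : K} (h : o ≤ o') (h' : o' ≤ o'') (t : A o),
    j (h.trans h') t = j h' (j h t)
  β : ∀ o, A o →⋆ₙₐ[ℂ] A o
  β_β : ∀ o (t : A o), β o (β o t) = t
  β_j : ∀ {o o' : K} (h : o ≤ o') (t : A o), β o' (j h t) = j h (β o t)

attribute [instance] GradedNet.ring GradedNet.starRing GradedNet.module GradedNet.scalarTower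
  GradedNet.smulComm GradedNet.starModule

/-! The fibre of the enveloping net bundle: the *-algebra of pairs `(p, t)` -/

section Fibre

variable {K : Type u} [PartialOrder K]

/-- Formal *-algebraic expressions in the symbols `(p, t)`, where `p : o → a` is a path
and `t ∈ A o`. -/
inductive FibreTerm (N : GradedNet.{u, v} K) (a : K) : Type (max u v)
  | gen {o : K} (p : PosetPath o a) (t : N.A o)
  | zero
  | add (x y : FibreTerm N a)
  | neg (x : FibreTerm N a)
  | smul (c : ℂ) (x : FibreTerm N a)
  | mul (x y : FibreTerm N a)
  | star (x : FibreTerm N a)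

open FibreTerm in
/-- The congruence generated by the axioms of a complex *-algebra and by the relations
`(p,t) + c (p,t') = (p, t + c t')`, `(p,t) (p,t') = (p, t t')`, `(p,t)* = (p, t*)`,
`(p * (o'o), t) = (p, j_{o'o} t)`, and `(p,t) = (p',t)` for homotopic `p`, `p'`. -/
inductive FibreRel (N : GradedNet.{u, v} K) (a : K) : FibreTerm N a → FibreTerm N a → Prop
  -- equivalence relation
  | refl (x) : FibreRel N a x x
  | symm {x y} : FibreRel N a x y → FibreRel N a y x
  | trans {x y z} : FibreRel N a x y → FibreRel N a y z → FibreRel N a x z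
  -- compatibility with the operations
  | add_congr {x x' y y'} :
      FibreRel N a x x' → FibreRel N a y y' → FibreRel N a (add x y) (add x' y')
  | neg_congr {x x'} : FibreRel N a x x' → FibreRel N a (neg x) (neg x')
  | smul_congr (c : ℂ) {x x'} : FibreRel N a x x' → FibreRel N a (smul c x) (smul c x')
  | mul_congr {x x' y y'} :
      FibreRel N a x x' → FibreRel N a y y' → FibreRel N a (mul x y) (mul x' y')
  | star_congr {x x'} : FibreRel N a x x' → FibreRel N a (star x) (star x')
  -- axioms of a complex *-algebra
  | add_assoc (x y z) : FibreRel N a (add (add x y) z) (add x (add y z))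
  | add_comm (x y) : FibreRel N a (add x y) (add y x)
  | zero_add (x) : FibreRel N a (add zero x) x
  | neg_add (x) : FibreRel N a (add (neg x) x) zero
  | smul_add (c : ℂ) (x y) : FibreRel N a (smul c (add x y)) (add (smul c x) (smul c y))
  | add_smul (c d : ℂ) (x) : FibreRel N a (smul (c + d) x) (add (smul c x) (smul d x))
  | mul_smul (c d : ℂ) (x) : FibreRel N a (smul (c * d) x) (smul c (smul d x))
  | one_smul (x) : FibreRel N a (smul 1 x) x
  | zero_smul (x) : FibreRel N a (smul 0 x) zero
  | smul_zero (c : ℂ) : FibreRel N a (smul c zero) zero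
  | mul_assoc (x y z) : FibreRel N a (mul (mul x y) z) (mul x (mul y z))
  | mul_add (x y z) : FibreRel N a (mul x (add y z)) (add (mul x y) (mul x z))
  | add_mul (x y z) : FibreRel N a (mul (add x y) z) (add (mul x z) (mul y z))
  | zero_mul (x) : FibreRel N a (mul zero x) zero
  | mul_zero (x) : FibreRel N a (mul x zero) zero
  | smul_mul (c : ℂ) (x y) : FibreRel N a (mul (smul c x) y) (smul c (mul x y))
  | mul_smul_comm (c : ℂ) (x y) : FibreRel N a (mul x (smul c y)) (smul c (mul x y))
  | star_star (x) : FibreRel N a (star (star x)) x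
  | star_add (x y) : FibreRel N a (star (add x y)) (add (star x) (star y))
  | star_mul (x y) : FibreRel N a (star (mul x y)) (mul (star y) (star x))
  | star_smul (c : ℂ) (x) :
      FibreRel N a (star (smul c x)) (smul (starRingEnd ℂ c) (star x))
  -- the relations among the generators
  | gen_add_smul {o : K} (p : PosetPath o a) (c : ℂ) (t t' : N.A o) :
      FibreRel N a (add (gen p t) (smul c (gen p t'))) (gen p (t + c • t'))
  | gen_mul {o : K} (p : PosetPath o a) (t t' : N.A o) :
      FibreRel N a (mul (gen p t) (gen p t')) (gen p (t * t'))
  | gen_star {o : K} (p : PosetPath o a) (t : N.A o) :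
      FibreRel N a (star (gen p t)) (gen p (Star.star t))
  | gen_incl {o o' : K} (h : o ≤ o') (p : PosetPath o' a) (t : N.A o) :
      FibreRel N a (gen (p.comp (.single (.ofLE h))) t) (gen p (N.j h t))
  | gen_homotopic {o : K} {p p' : PosetPath o a} (h : p.Homotopic p') (t : N.A o) :
      FibreRel N a (gen p t) (gen p' t)

/-- The congruence as a setoid. -/
def fibreSetoid (N : GradedNet.{u, v} K) (a : K) : Setoid (FibreTerm N a) :=
  ⟨FibreRel N a, .refl, .symm, .trans⟩

/-- The *-algebra `A`, fibre over `a` of the enveloping net bundle of the net `N`: the *-algebra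
generated by the pairs `(p, t)` with the above relations. -/
def Fibre (N : GradedNet.{u, v} K) (a : K) : Type (max u v) := Quotient (fibreSetoid N a)

namespace Fibre

variable {N : GradedNet.{u, v} K} {a : K}

/-- The class of a formal expression. -/
def ofTerm (x : FibreTerm N a) : Fibre N a := Quotient.mk _ x

/-- The element `(p, t)` of the fibre. -/
def gen {o : K} (p : PosetPath o a) (t : N.A o) : Fibre N a := ofTerm (.gen p t)

instance : Zero (Fibre N a) := ⟨Quotient.mk _ .zero⟩
instance : Add (Fibre N a) := ⟨Quotient.map₂ .add fun _ _ h _ _ h' => .add_congr h h'⟩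
instance : Neg (Fibre N a) := ⟨Quotient.map .neg fun _ _ h => .neg_congr h⟩
instance : Mul (Fibre N a) := ⟨Quotient.map₂ .mul fun _ _ h _ _ h' => .mul_congr h h'⟩
instance : SMul ℂ (Fibre N a) := ⟨fun c => Quotient.map (.smul c) fun _ _ h => .smul_congr c h⟩
instance : Star (Fibre N a) := ⟨Quotient.map .star fun _ _ h => .star_congr h⟩

instance : AddCommGroup (Fibre N a) where
  add_assoc := by rintro ⟨x⟩ ⟨y⟩ ⟨z⟩; exact Quotient.sound (.add_assoc x y z)
  zero_add := by rintro ⟨x⟩; exact Quotient.sound (.zero_add x)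
  add_zero := by rintro ⟨x⟩; exact Quotient.sound ((FibreRel.add_comm x .zero).trans (.zero_add x))
  neg_add_cancel := by rintro ⟨x⟩; exact Quotient.sound (.neg_add x)
  add_comm := by rintro ⟨x⟩ ⟨y⟩; exact Quotient.sound (.add_comm x y)
  nsmul := nsmulRec
  zsmul := zsmulRec

instance : NonUnitalRing (Fibre N a) where
  left_distrib := by rintro ⟨x⟩ ⟨y⟩ ⟨z⟩; exact Quotient.sound (.mul_add x y z)
  right_distrib := by rintro ⟨x⟩ ⟨y⟩ ⟨z⟩; exact Quotient.sound (.add_mul x y z)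
  zero_mul := by rintro ⟨x⟩; exact Quotient.sound (.zero_mul x)
  mul_zero := by rintro ⟨x⟩; exact Quotient.sound (.mul_zero x)
  mul_assoc := by rintro ⟨x⟩ ⟨y⟩ ⟨z⟩; exact Quotient.sound (.mul_assoc x y z)

instance : Module ℂ (Fibre N a) where
  one_smul := by rintro ⟨x⟩; exact Quotient.sound (.one_smul x)
  mul_smul := by rintro c d ⟨x⟩; exact Quotient.sound (.mul_smul c d x)
  smul_zero := by rintro c; exact Quotient.sound (.smul_zero c)
  smul_add := by rintro c ⟨x⟩ ⟨y⟩; exact Quotient.sound (.smul_add c x y)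
  add_smul := by rintro c d ⟨x⟩; exact Quotient.sound (.add_smul c d x)
  zero_smul := by rintro ⟨x⟩; exact Quotient.sound (.zero_smul x)

instance : IsScalarTower ℂ (Fibre N a) (Fibre N a) where
  smul_assoc := by rintro c ⟨x⟩ ⟨y⟩; exact Quotient.sound (.smul_mul c x y)

instance : SMulCommClass ℂ (Fibre N a) (Fibre N a) where
  smul_comm := by rintro c ⟨x⟩ ⟨y⟩; exact Quotient.sound (.symm (.mul_smul_comm c x y))

instance : StarRing (Fibre N a) where
  star_involutive := by rintro ⟨x⟩; exact Quotient.sound (.star_star x)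
  star_mul := by rintro ⟨x⟩ ⟨y⟩; exact Quotient.sound (.star_mul x y)
  star_add := by rintro ⟨x⟩ ⟨y⟩; exact Quotient.sound (.star_add x y)

instance : StarModule ℂ (Fibre N a) where
  star_smul := by rintro c ⟨x⟩; exact Quotient.sound (.star_smul c x)

section Lift

variable {B : Type*} [NonUnitalRing B] [StarRing B] [Module ℂ B]

/-- Evaluation of a formal expression in a *-algebra. -/
def termValue (f : ∀ {o : K}, PosetPath o a → N.A o → B) : FibreTerm N a → B
  | .gen p t => f p t
  | .zero => 0
  | .add x y => termValue f x + termValue f y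
  | .neg x => - termValue f x
  | .smul c x => c • termValue f x
  | .mul x y => termValue f x * termValue f y
  | .star x => star (termValue f x)

/-- The *-morphism on the fibre determined by its values on the generators. -/
def lift [IsScalarTower ℂ B B] [SMulCommClass ℂ B B] [StarModule ℂ B]
    (f : ∀ {o : K}, PosetPath o a → (N.A o →⋆ₙₐ[ℂ] B))
    (f_incl : ∀ {o o' : K} (h : o ≤ o') (p : PosetPath o' a) (t : N.A o),
      f (p.comp (.single (.ofLE h))) t = f p (N.j h t))
    (f_homotopic : ∀ {o : K} {p p' : PosetPath o a}, p.Homotopic p' → ∀ t : N.A o,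
      f p t = f p' t) : Fibre N a →⋆ₙₐ[ℂ] B where
  toFun := Quotient.lift (termValue fun p t => f p t) (by
    intro x y h
    change FibreRel N a x y at h
    induction h with
    | refl x => rfl
    | symm _ ih => exact ih.symm
    | trans _ _ ih₁ ih₂ => exact ih₁.trans ih₂
    | add_congr _ _ ih₁ ih₂ => simp only [termValue, ih₁, ih₂]
    | neg_congr _ ih => simp only [termValue, ih]
    | smul_congr c _ ih => simp only [termValue, ih]
    | mul_congr _ _ ih₁ ih₂ => simp only [termValue, ih₁, ih₂]
    | star_congr _ ih => simp only [termValue, ih]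
    | add_assoc x y z => exact _root_.add_assoc _ _ _
    | add_comm x y => exact _root_.add_comm _ _
    | zero_add x => exact _root_.zero_add _
    | neg_add x => exact neg_add_cancel _
    | smul_add c x y => exact _root_.smul_add _ _ _
    | add_smul c d x => exact _root_.add_smul _ _ _
    | mul_smul c d x => exact SemigroupAction.mul_smul _ _ _
    | one_smul x => exact _root_.one_smul _ _
    | zero_smul x => exact _root_.zero_smul _ _
    | smul_zero c => exact _root_.smul_zero _
    | mul_assoc x y z => exact _root_.mul_assoc _ _ _
    | mul_add x y z => exact _root_.mul_add _ _ _
    | add_mul x y z => exact _root_.add_mul _ _ _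
    | zero_mul x => exact MulZeroClass.zero_mul _
    | mul_zero x => exact MulZeroClass.mul_zero _
    | smul_mul c x y => exact smul_mul_assoc _ _ _
    | mul_smul_comm c x y => exact _root_.mul_smul_comm _ _ _
    | star_star x => exact _root_.star_star _
    | star_add x y => exact StarAddMonoid.star_add _ _
    | star_mul x y => exact StarMul.star_mul _ _
    | star_smul c x => exact StarModule.star_smul _ _
    | gen_add_smul p c t t' => simp only [termValue, map_add, map_smul]
    | gen_mul p t t' => simp only [termValue, map_mul]
    | gen_star p t => simp only [termValue, map_star]
    | gen_incl h p t => exact f_incl h p t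
    | gen_homotopic h t => exact f_homotopic h t)
  map_smul' := by rintro c ⟨x⟩; rfl
  map_zero' := rfl
  map_add' := by rintro ⟨x⟩ ⟨y⟩; rfl
  map_mul' := by rintro ⟨x⟩ ⟨y⟩; rfl
  map_star' := by rintro ⟨x⟩; rfl

/-- Two *-morphisms on the fibre agree if they agree on the generators `(p, t)`. -/
theorem hom_ext {F G : Fibre N a →⋆ₙₐ[ℂ] B}
    (h : ∀ (o : K) (p : PosetPath o a) (t : N.A o), F (gen p t) = G (gen p t)) : F = G := by
  refine DFunLike.ext _ _ ?_
  rintro ⟨x⟩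
  change F (ofTerm x) = G (ofTerm x)
  induction x with
  | gen p t => exact h _ p t
  | zero => exact (map_zero F).trans (map_zero G).symm
  | add x y hx hy =>
    have e : (ofTerm (FibreTerm.add x y) : Fibre N a) =
      ofTerm x + ofTerm y := rfl
    rw [e, map_add, map_add, hx, hy]
  | neg x hx =>
    have e : (ofTerm (FibreTerm.neg x) : Fibre N a) = - ofTerm x := rfl
    rw [e, map_neg, map_neg, hx]
  | smul c x hx =>
    have e : (ofTerm (FibreTerm.smul c x) : Fibre N a) = c • ofTerm x := rfl
    rw [e, map_smul, map_smul, hx]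
  | mul x y hx hy =>
    have e : (ofTerm (FibreTerm.mul x y) : Fibre N a) =
      ofTerm x * ofTerm y := rfl
    rw [e, map_mul, map_mul, hx, hy]
  | star x hx =>
    have e : (ofTerm (FibreTerm.star x) : Fibre N a) = Star.star (ofTerm x) := rfl
    rw [e, map_star, map_star, hx]

end Lift

/-- For fixed `p : o → a`, the *-morphism `t ↦ (p, t)` from `A o` to the fibre. -/
def genHom {o : K} (p : PosetPath o a) : N.A o →⋆ₙₐ[ℂ] Fibre N a :=
  have hadd (c : ℂ) (t t' : N.A o) :
      (gen p t + c • gen p t' : Fibre N a) = gen p (t + c • t') :=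
    Quotient.sound (.gen_add_smul p c t t')
  have hzero : (gen p (0 : N.A o) : Fibre N a) = 0 := by
    have h := hadd (-1) (0 : N.A o) 0
    simpa using h.symm
  { toFun := fun t => gen p t
    map_smul' := fun c t => by
      have h := hadd c (0 : N.A o) t
      rw [hzero, zero_add, zero_add] at h
      exact h.symm
    map_zero' := hzero
    map_add' := fun t t' => by
      have h := hadd 1 t t'
      rw [one_smul, one_smul] at h
      exact h.symm
    map_mul' := fun t t' => (Quotient.sound (.gen_mul p t t') :
      (gen p t * gen p t' : Fibre N a) = gen p (t * t')).symm
    map_star' := fun t => (Quotient.sound (.gen_star p t) :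
      (star (gen p t) : Fibre N a) = gen p (star t)).symm }

/-- The automorphism `(p, t) ↦ (g * p, t)` defined by a loop `g` over `a`. -/
def loopAct (g : PosetPath a a) : Fibre N a →⋆ₙₐ[ℂ] Fibre N a :=
  lift (fun p => genHom (g.comp p))
    (fun h p t => by
      rw [← PosetPath.comp_assoc]
      exact Quotient.sound (.gen_incl h (g.comp p) t))
    (fun h t => Quotient.sound (.gen_homotopic ((PosetPath.Homotopic.refl g).comp h) t))

/-- The action of `Π = π₁ᵃ(K)` on the fibre: `[g] (p, t) = (g * p, t)`. -/
def action (N : GradedNet.{u, v} K) (a : K) :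
    HomotopyGroup a →* (Fibre N a →⋆ₙₐ[ℂ] Fibre N a) where
  toFun := Quotient.lift loopAct fun _ _ h => hom_ext fun _ p t =>
    Quotient.sound (.gen_homotopic (PosetPath.Homotopic.comp h (.refl p)) t)
  map_one' := hom_ext fun _ p t => Quotient.sound (.gen_homotopic (PosetPath.triv_comp p) t)
  map_mul' := by
    rintro ⟨g⟩ ⟨g'⟩
    refine hom_ext fun _ p t => ?_
    change gen ((g.comp g').comp p) t = gen (g.comp (g'.comp p)) t
    rw [PosetPath.comp_assoc]

/-- The grading of the fibre induced by that of the net: `(p, t) ↦ (p, β t)`. -/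
def grading (N : GradedNet.{u, v} K) (a : K) : Fibre N a →⋆ₙₐ[ℂ] Fibre N a :=
  lift (fun {o} p => (genHom p).comp (N.β o))
    (fun {o o'} h p t => by
      have e : (gen (p.comp (.single (.ofLE h))) (N.β o t) : Fibre N a) =
          gen p (N.j h (N.β o t)) := Quotient.sound (.gen_incl h p _)
      rw [← N.β_j] at e
      exact e)
    (fun h _ => Quotient.sound (.gen_homotopic h _))

end Fibre

end Fibre

/-! Unbounded operators, `θ`-summability and superderivations -/

section Operators

variable {H : Type w} [NormedAddCommGroup H] [InnerProductSpace ℂ H]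
  {H' : Type w} [NormedAddCommGroup H'] [InnerProductSpace ℂ H']

/-- The identity `V D V* = D'` of partially defined operators, domains included: the map
`V ⊕ V` identifies the graph of `D` with that of `D'`. -/
def Conjugates (V : H ≃ₗᵢ[ℂ] H') (D : H →ₗ.[ℂ] H) (D' : H' →ₗ.[ℂ] H') : Prop :=
  ∀ x y : H, (x, y) ∈ D.graph ↔ (V x, V y) ∈ D'.graph

/-- `T t = e^{-t D²}` for `t ≥ 0`: `T` is the strongly continuous one-parameter semigroup with
generator `-D²`, where `D²` has its natural domain `{x ∈ Dom D | D x ∈ Dom D}`. -/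
structure IsHeatSemigroup (D : H →ₗ.[ℂ] H) (T : ℝ≥0 → H →L[ℂ] H) : Prop where
  zero : T 0 = 1
  add : ∀ s t, T (s + t) = T s * T t
  continuous : ∀ x, Continuous fun t => T t x
  generator : ∀ x y : H, (∃ z, (x, z) ∈ D.graph ∧ (z, y) ∈ D.graph) ↔
    Tendsto (fun t : ℝ≥0 => ((t : ℝ) : ℂ)⁻¹ • (x - T t x)) (𝓝[>] 0) (𝓝 y)

/-- `Tr T < ∞` for a positive bounded operator `T`; the trace is computed in a Hilbert basis. -/
def FiniteTrace (T : H →L[ℂ] H) : Prop :=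
  ∀ (ι : Type w) (b : HilbertBasis ι ℂ H),
    ∑' i, ENNReal.ofReal (RCLike.re (inner ℂ (b i) (T (b i)))) < ⊤

/-- `θ`-summability: `Tr e^{-β D²} < ∞` for all `β > 0`. -/
def ThetaSummable (D : H →ₗ.[ℂ] H) : Prop :=
  ∃ T : ℝ≥0 → H →L[ℂ] H, IsHeatSemigroup D T ∧ ∀ β : ℝ≥0, 0 < β → FiniteTrace (T β)

/-- The domain of the superderivation `δ(t) = D t - Γ t Γ D`: the bounded operators `t` for which
there is a bounded `b` with `Γ t Γ D ⊆ D t - b` (so that `δ(t) = b` on `Dom D`). -/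
def superDom (Γ : H ≃ₗᵢ[ℂ] H) (D : H →ₗ.[ℂ] H) : Set (H →L[ℂ] H) :=
  {t | ∃ b : H →L[ℂ] H, ∀ x : D.domain, ∃ h : t x ∈ D.domain,
    Γ (t (Γ (D x))) = D ⟨t x, h⟩ - b x}

/-- `D` is a densely defined (not necessarily bounded) selfadjoint operator, odd with respect to
`Γ` (i.e. `Γ D Γ = -D`), and `θ`-summable. -/
structure IsOddThetaSummable [CompleteSpace H] (Γ : H ≃ₗᵢ[ℂ] H) (D : H →ₗ.[ℂ] H) : Prop where
  dense : Dense (D.domain : Set H)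
  selfAdjoint : IsSelfAdjoint D
  odd : ∀ x y : H, (x, y) ∈ D.graph ↔ (Γ x, - Γ y) ∈ D.graph
  theta : ThetaSummable D

end Operators

/-! Nets of spectral triples -/

section Nets

variable {K : Type u} [PartialOrder K]

/-- An even `θ`-summable net of spectral triples `(H, U, Γ, D, π)` over the graded net `N`. A
grading `Γ` is a unitary with `Γ² = 1`, hence selfadjoint. -/
structure SpectralNet (N : GradedNet.{u, v} K) where
  H : K → Type w
  [normed : ∀ o, NormedAddCommGroup (H o)]
  [inner : ∀ o, InnerProductSpace ℂ (H o)]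
  [complete : ∀ o, CompleteSpace (H o)]
  U : ∀ {o o' : K}, o ≤ o' → (H o ≃ₗᵢ[ℂ] H o')
  U_comp : ∀ {o o' o'' : K} (h : o ≤ o') (h' : o' ≤ o'') (x : H o),
    U (h.trans h') x = U h' (U h x)
  Γ : ∀ o, H o ≃ₗᵢ[ℂ] H o
  Γ_Γ : ∀ o (x : H o), Γ o (Γ o x) = x
  Γ_U : ∀ {o o' : K} (h : o ≤ o') (x : H o), Γ o' (U h x) = U h (Γ o x)
  π : ∀ o, N.A o →⋆ₙₐ[ℂ] (H o →L[ℂ] H o)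
  /-- `Ad U_{o'o} ∘ π_o = π_{o'} ∘ j_{o'o}`. -/
  π_j : ∀ {o o' : K} (h : o ≤ o') (t : N.A o) (x : H o),
    π o' (N.j h t) (U h x) = U h (π o t x)
  /-- `Ad Γ_o ∘ π_o = π_o ∘ β_o`. -/
  π_graded : ∀ o (t : N.A o) (x : H o), π o (N.β o t) x = Γ o (π o t (Γ o x))
  D : ∀ o, H o →ₗ.[ℂ] H o
  D_odd : ∀ o, IsOddThetaSummable (Γ o) (D o)
  D_U : ∀ {o o' : K} (h : o ≤ o'), Conjugates (U h) (D o) (D o')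
  π_mem : ∀ o (t : N.A o), π o t ∈ superDom (Γ o) (D o)

attribute [instance] SpectralNet.normed SpectralNet.inner SpectralNet.complete

namespace SpectralNet

variable {N : GradedNet.{u, v} K}

/-- The unitary `U_b = U_{∂₀b |b|} U_{|b| ∂₁b}` of a 1-simplex. -/
def simplexU (S : SpectralNet.{u, v, w} N) {a o : K} (b : Simplex1 a o) :
    S.H a ≃ₗᵢ[ℂ] S.H o :=
  (S.U b.le_left).trans (S.U b.le_right).symm

/-- The unitary `U_p = U_{b_n} ⋯ U_{b_1}` of a path `p = b_n * ⋯ * b_1`. -/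
def pathU (S : SpectralNet.{u, v, w} N) {a : K} :
    {o : K} → PosetPath a o → (S.H a ≃ₗᵢ[ℂ] S.H o)
  | _, .single b => S.simplexU b
  | _, .step b p => (pathU S p).trans (S.simplexU b)

/-- Unitary morphisms of nets of spectral triples. -/
@[ext]
structure Hom (S S' : SpectralNet.{u, v, w} N) where
  V : ∀ o, S.H o ≃ₗᵢ[ℂ] S'.H o
  V_U : ∀ {o o' : K} (h : o ≤ o') (x : S.H o), V o' (S.U h x) = S'.U h (V o x)
  V_Γ : ∀ o (x : S.H o), V o (S.Γ o x) = S'.Γ o (V o x)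
  V_π : ∀ o (t : N.A o) (x : S.H o), V o (S.π o t x) = S'.π o t (V o x)
  V_D : ∀ o, Conjugates (V o) (S.D o) (S'.D o)

/-- The category `ncg(N)` of nets of spectral triples. -/
instance : CategoryTheory.Category (SpectralNet.{u, v, w} N) where
  Hom := Hom
  id S :=
    { V := fun o => LinearIsometryEquiv.refl ℂ (S.H o)
      V_U := fun _ _ => rfl
      V_Γ := fun _ _ => rfl
      V_π := fun _ _ _ => rfl
      V_D := fun _ _ _ => Iff.rfl }
  comp F G :=
    { V := fun o => (F.V o).trans (G.V o)
      V_U := fun h x => by simp [F.V_U, G.V_U]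
      V_Γ := fun o x => by simp [F.V_Γ, G.V_Γ]
      V_π := fun o t x => by simp [F.V_π, G.V_π]
      V_D := fun o x y => (F.V_D o x y).trans (G.V_D o _ _) }

end SpectralNet

end Nets

/-! Equivariant spectral triples -/

section Equivariant

variable {G : Type u} [Group G] {A : Type v} [NonUnitalRing A] [StarRing A] [Module ℂ A]
  [IsScalarTower ℂ A A] [SMulCommClass ℂ A A] [StarModule ℂ A]

/-- A `G`-equivariant even `θ`-summable spectral triple `(H, Γ, D, π, u)` over the *-algebra `A`,
which carries the `G`-action `α` and the grading `γ`. -/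
structure EquivTriple (α : G →* (A →⋆ₙₐ[ℂ] A)) (γ : A →⋆ₙₐ[ℂ] A) where
  H : Type w
  [normed : NormedAddCommGroup H]
  [inner : InnerProductSpace ℂ H]
  [complete : CompleteSpace H]
  Γ : H ≃ₗᵢ[ℂ] H
  Γ_Γ : ∀ x : H, Γ (Γ x) = x
  u : G →* (H ≃ₗᵢ[ℂ] H)
  u_Γ : ∀ (g : G) (x : H), u g (Γ x) = Γ (u g x)
  π : A →⋆ₙₐ[ℂ] (H →L[ℂ] H)
  /-- `Ad Γ ∘ π = π ∘ γ`. -/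
  π_graded : ∀ (t : A) (x : H), π (γ t) x = Γ (π t (Γ x))
  /-- `π (g t) = u_g π(t) u_g*`. -/
  π_equivariant : ∀ (g : G) (t : A) (x : H), π (α g t) (u g x) = u g (π t x)
  D : H →ₗ.[ℂ] H
  D_odd : IsOddThetaSummable Γ D
  D_u : ∀ g : G, Conjugates (u g) D D
  π_mem : ∀ t : A, π t ∈ superDom Γ D

attribute [instance] EquivTriple.normed EquivTriple.inner EquivTriple.complete

namespace EquivTriple

variable {α : G →* (A →⋆ₙₐ[ℂ] A)} {γ : A →⋆ₙₐ[ℂ] A}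

/-- Equivariant unitary morphisms of equivariant spectral triples. -/
@[ext]
structure Hom (S S' : EquivTriple.{u, v, w} α γ) where
  V : S.H ≃ₗᵢ[ℂ] S'.H
  V_u : ∀ (g : G) (x : S.H), V (S.u g x) = S'.u g (V x)
  V_Γ : ∀ x : S.H, V (S.Γ x) = S'.Γ (V x)
  V_π : ∀ (t : A) (x : S.H), V (S.π t x) = S'.π t (V x)
  V_D : Conjugates V S.D S'.D

/-- The category `ncg_G(A)` of `G`-equivariant spectral triples over `A`. -/
instance : CategoryTheory.Category (EquivTriple.{u, v, w} α γ) where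
  Hom := Hom
  id S :=
    { V := LinearIsometryEquiv.refl ℂ S.H
      V_u := fun _ _ => rfl
      V_Γ := fun _ => rfl
      V_π := fun _ _ => rfl
      V_D := fun _ _ => Iff.rfl }
  comp F F' :=
    { V := F.V.trans F'.V
      V_u := fun g x => by simp [F.V_u, F'.V_u]
      V_Γ := fun x => by simp [F.V_Γ, F'.V_Γ]
      V_π := fun t x => by simp [F.V_π, F'.V_π]
      V_D := fun x y => (F.V_D x y).trans (F'.V_D _ _) }

end EquivTriple

end Equivariant

section Correspondence

variable {K : Type u} [PartialOrder K] {N : GradedNet.{u, v} K}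

/-- The category `ncg_Π(A)`, where `Π = π₁ᵃ(K)` and `A` is the fibre over `a` of the enveloping
net bundle of `N`, with its holonomy action and its induced grading. -/
abbrev FibreTriple (N : GradedNet.{u, v} K) (a : K) :=
  EquivTriple.{u, max u v, w} (Fibre.action N a) (Fibre.grading N a)

/-- The unitary `W` identifies the equivariant spectral triple `T` with the holonomy data
`(H_a, Γ_a, D_a, π_*, U_*)` of the net of spectral triples `S`, where
`π_*(p, t) = U_p π_o(t) U_p*` and `U_{*,[p]} = U_p`. -/
structure IsHolonomyTriple {a : K} (S : SpectralNet.{u, v, w} N) (T : FibreTriple.{u, v, w} N a)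
    (W : S.H a ≃ₗᵢ[ℂ] T.H) : Prop where
  grading : ∀ x, W (S.Γ a x) = T.Γ (W x)
  dirac : Conjugates W (S.D a) T.D
  rep : ∀ (o : K) (p : PosetPath o a) (t : N.A o) (x : S.H o),
    T.π (Fibre.gen p t) (W (S.pathU p x)) = W (S.pathU p (S.π o t x))
  unitary : ∀ (p : PosetPath a a) (x : S.H a),
    T.u (HomotopyGroup.mk p) (W x) = W (S.pathU p x)

end Correspondence

end NetSpectral

/-!
A path `p : x → y` transports the fibre of a net of spectral triples by the unitary `U_p`. Because
`U_{o''o} = U_{o''o'} U_{o'o}`, the support of a 1-simplex may be enlarged freely in `U_b`, so that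
`U_p` depends only on the homotopy class of `p` (`SpectralNet.pathU_homotopic`). Hence
`[p] ↦ U_p` is a unitary representation of `π₁ᵃ(K)` on `H_a`, and `(p, t) ↦ U_p π_o(t) U_p*`
respects the relations of the fibre algebra. The only analytic point is that the whole image of the
fibre algebra, not just that of the generators, lies in the domain of the superderivation: this
domain is a *-algebra because `D` is selfadjoint and odd (`superDomAlgebra`). This gives the functor
`S ↦ (H_a, Γ_a, D_a, π_*, U_*)`, `V ↦ V_a` (`SpectralNet.holonomyFunctor`).

The functor is an equivalence when `K` is pathwise connected. It is faithful because
`V_a U_p = U'_p V_o` for `p : o → a` determines `V_o` from `V_a`. It is full because, for a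
`Π`-equivariant `V`, the unitary `U'_p* V U_p` does not depend on `p : o → a`. It is essentially
surjective because, after a choice of paths `p_o : o → a`, a triple `(H, Γ, D, π, u)` comes from
the net with all fibres `H`, with `U_{o'o} = u [p_{o'} * (o'o) * p_o⁻¹]` and `π_o(t) = π(p_o, t)`
(`EquivTriple.toNet`, `EquivTriple.toNetIso`).
-/

namespace NetSpectral

open CategoryTheory

/-! ### The domain of the superderivation is a *-algebra -/

section SuperDomain

variable {H : Type w} [NormedAddCommGroup H] [InnerProductSpace ℂ H]
  {H' : Type w} [NormedAddCommGroup H'] [InnerProductSpace ℂ H']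
  {H'' : Type w} [NormedAddCommGroup H''] [InnerProductSpace ℂ H'']

theorem Conjugates.symm {V : H ≃ₗᵢ[ℂ] H'} {D : H →ₗ.[ℂ] H} {D' : H' →ₗ.[ℂ] H'}
    (h : Conjugates V D D') : Conjugates V.symm D' D := fun x y => by
  simpa using (h (V.symm x) (V.symm y)).symm

theorem Conjugates.trans {V : H ≃ₗᵢ[ℂ] H'} {V' : H' ≃ₗᵢ[ℂ] H''} {D : H →ₗ.[ℂ] H}
    {D' : H' →ₗ.[ℂ] H'} {D'' : H'' →ₗ.[ℂ] H''}
    (h : Conjugates V D D') (h' : Conjugates V' D' D'') : Conjugates (V.trans V') D D'' :=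
  fun x y => (h x y).trans (h' _ _)

/-- Membership in the domain of the superderivation in terms of the graph of `D`: the pair
`(t x, Γ t Γ y + b x)` lies in the graph whenever `(x, y)` does. -/
theorem mem_superDom_iff {Γ : H ≃ₗᵢ[ℂ] H} {D : H →ₗ.[ℂ] H} {t : H →L[ℂ] H} :
    t ∈ superDom Γ D ↔ ∃ b : H →L[ℂ] H, ∀ x y : H, (x, y) ∈ D.graph →
      (t x, Γ (t (Γ y)) + b x) ∈ D.graph := by
  refine exists_congr fun b => ⟨fun h x y hxy => ?_, fun h x => ?_⟩
  · obtain ⟨x', rfl, rfl⟩ := (LinearPMap.mem_graph_iff D).1 hxy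
    obtain ⟨hx, e⟩ := h x'
    exact (LinearPMap.mem_graph_iff D).2 ⟨⟨_, hx⟩, rfl, by simp [e]⟩
  · obtain ⟨z, hz, e⟩ := (LinearPMap.mem_graph_iff D).1 (h x (D x) (D.mem_graph x))
    dsimp only at hz e
    refine ⟨hz ▸ z.2, ?_⟩
    have : z = ⟨t x, hz ▸ z.2⟩ := Subtype.ext hz
    rw [← this, e, add_sub_cancel_right]

/-- The *-isomorphism `ad V : t ↦ V t V*` of the algebras of bounded operators. -/
noncomputable def conjHom [CompleteSpace H] [CompleteSpace H'] (V : H ≃ₗᵢ[ℂ] H') :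
    (H →L[ℂ] H) →⋆ₙₐ[ℂ] (H' →L[ℂ] H') where
  toFun := V.conjStarAlgEquiv
  map_smul' := map_smul V.conjStarAlgEquiv
  map_zero' := map_zero _
  map_add' := map_add _
  map_mul' := map_mul _
  map_star' := map_star V.conjStarAlgEquiv

theorem conjHom_apply [CompleteSpace H] [CompleteSpace H'] (V : H ≃ₗᵢ[ℂ] H') (t : H →L[ℂ] H)
    (x : H') : conjHom V t x = V (t (V.symm x)) := rfl

theorem conjHom_apply_map [CompleteSpace H] [CompleteSpace H'] (V : H ≃ₗᵢ[ℂ] H') (t : H →L[ℂ] H)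
    (x : H) : conjHom V t (V x) = V (t x) := by
  rw [conjHom_apply, V.symm_apply_apply]

theorem conjHom_mem_superDom [CompleteSpace H] [CompleteSpace H'] {Γ : H ≃ₗᵢ[ℂ] H}
    {Γ' : H' ≃ₗᵢ[ℂ] H'} {D : H →ₗ.[ℂ] H} {D' : H' →ₗ.[ℂ] H'} {V : H ≃ₗᵢ[ℂ] H'}
    (hΓ : ∀ x, V (Γ x) = Γ' (V x)) (hD : Conjugates V D D') {t : H →L[ℂ] H}
    (ht : t ∈ superDom Γ D) : conjHom V t ∈ superDom Γ' D' := by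
  have hΓ' (x) : V.symm (Γ' x) = Γ (V.symm x) := by
    rw [LinearIsometryEquiv.symm_apply_eq, hΓ, V.apply_symm_apply]
  obtain ⟨b, hb⟩ := mem_superDom_iff.1 ht
  refine mem_superDom_iff.2 ⟨conjHom V b, fun x y hxy => ?_⟩
  have := (hD _ _).1 (hb _ _ ((hD.symm _ _).1 hxy))
  simpa [hΓ, hΓ', conjHom_apply] using this

/-- The graph of a selfadjoint operator is its own adjoint. -/
theorem mem_graph_iff_of_isSelfAdjoint [CompleteSpace H] {D : H →ₗ.[ℂ] H} (hD : IsSelfAdjoint D) {x y : H} :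
    (x, y) ∈ D.graph ↔ ∀ z w : H, (z, w) ∈ D.graph → inner ℂ w x = inner ℂ z y := by
  have h := LinearPMap.adjoint_graph_eq_graph_adjoint hD.dense_domain
  rw [LinearPMap.isSelfAdjoint_def.1 hD] at h
  conv_lhs => rw [h, Submodule.mem_adjoint_iff]
  simp only [sub_eq_zero]

/-- A grading is symmetric. -/
theorem inner_grading_left {Γ : H ≃ₗᵢ[ℂ] H} (hΓ : ∀ x, Γ (Γ x) = x) (x y : H) :
    inner ℂ (Γ x) y = inner ℂ x (Γ y) := by
  rw [← Γ.inner_map_map x (Γ y), hΓ]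

/-- The domain of the superderivation `δ` of an odd selfadjoint operator `D`, as a *-algebra of
bounded operators. It is closed under products by the graded Leibniz rule
`δ(s t) = δ(s) t + Γ s Γ δ(t)`, and under adjoints because `D` is selfadjoint and odd:
`δ(t*) = Γ δ(t)* Γ`. -/
def superDomAlgebra [CompleteSpace H] {Γ : H ≃ₗᵢ[ℂ] H} (hΓ : ∀ x, Γ (Γ x) = x) {D : H →ₗ.[ℂ] H}
    (hD : IsOddThetaSummable Γ D) : NonUnitalStarSubalgebra ℂ (H →L[ℂ] H) where
  carrier := superDom Γ D
  zero_mem' := mem_superDom_iff.2 ⟨0, fun x y _ => by simp⟩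
  add_mem' := by
    intro s t hs ht
    obtain ⟨b, hb⟩ := mem_superDom_iff.1 hs
    obtain ⟨c, hc⟩ := mem_superDom_iff.1 ht
    refine mem_superDom_iff.2 ⟨b + c, fun x y h => ?_⟩
    have := D.graph.add_mem (hb x y h) (hc x y h)
    simpa [add_add_add_comm] using this
  smul_mem' := by
    intro k t ht
    obtain ⟨b, hb⟩ := mem_superDom_iff.1 ht
    refine mem_superDom_iff.2 ⟨k • b, fun x y h => ?_⟩
    have := D.graph.smul_mem k (hb x y h)
    simpa using this
  mul_mem' := by
    intro s t hs ht
    obtain ⟨b, hb⟩ := mem_superDom_iff.1 hs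
    obtain ⟨c, hc⟩ := mem_superDom_iff.1 ht
    refine mem_superDom_iff.2
      ⟨b * t + (Γ : H →L[ℂ] H) * s * (Γ : H →L[ℂ] H) * c, fun x y h => ?_⟩
    have := hb _ _ (hc x y h)
    simpa [hΓ, add_assoc, add_left_comm, add_comm] using this
  star_mem' := by
    intro t ht
    obtain ⟨b, hb⟩ := mem_superDom_iff.1 ht
    refine mem_superDom_iff.2
      ⟨(Γ : H →L[ℂ] H) * star b * (Γ : H →L[ℂ] H), fun x y h => ?_⟩
    refine (mem_graph_iff_of_isSelfAdjoint hD.selfAdjoint).2 fun z w hzw => ?_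
    -- Conjugating the relation for `t` by the odd symmetry `(x, y) ↦ (Γ x, - Γ y)` of the graph
    -- gives a relation for `Γ t Γ`, which is paired with `(x, y)`.
    have h₁ := (hD.odd _ _).1 (hb _ _ ((hD.odd _ _).1 hzw))
    have h₂ := (mem_graph_iff_of_isSelfAdjoint hD.selfAdjoint).1 h _ _ h₁
    simp only [map_neg, map_add, hΓ, inner_neg_left, inner_add_left, neg_add_rev, neg_neg] at h₂
    simp only [ContinuousLinearMap.star_eq_adjoint, ContinuousLinearMap.adjoint_inner_right,
      mul_apply_eq_comp, inner_add_right, ContinuousLinearEquiv.coe_coe,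
      LinearIsometryEquiv.coe_toContinuousLinearEquiv, ← inner_grading_left hΓ] at h₂ ⊢
    rw [← h₂]
    ring

end SuperDomain

/-! ### Transport along paths -/

section Paths

variable {K : Type u} [PartialOrder K]

theorem PosetPath.comp_triv {x y : K} (p : PosetPath x y) :
    PosetPath.Homotopic (p.comp (.triv x)) p := by
  have key {o : K} (b : Simplex1 x o) :
      PosetPath.Homotopic (.step b (.single (.ofLE (le_refl x)))) (.single b) :=
    (PosetPath.Homotopic.deform (Simplex1.ofLE le_rfl) b b b.supp le_rfl le_rfl b.le_left).symm
  induction p with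
  | single b => exact key b
  | step b q ih => exact PosetPath.Homotopic.comp (.refl (.single b)) ih

/-- A *-subalgebra that contains the images of the generators `(p, t)` contains the image of the
whole fibre. -/
theorem Fibre.apply_mem_of_gen {N : GradedNet.{u, v} K} {a : K} {B : Type*} [NonUnitalRing B]
    [StarRing B] [Module ℂ B] (F : Fibre N a →⋆ₙₐ[ℂ] B) (S : NonUnitalStarSubalgebra ℂ B)
    (h : ∀ (o : K) (p : PosetPath o a) (t : N.A o), F (gen p t) ∈ S) (x : Fibre N a) :
    F x ∈ S := by
  obtain ⟨x⟩ := x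
  change F (ofTerm x) ∈ S
  induction x with
  | gen p t => exact h _ p t
  | zero => exact (map_zero F).symm ▸ S.zero_mem
  | add x y hx hy => exact (map_add F (ofTerm x) (ofTerm y)).symm ▸ S.add_mem hx hy
  | neg x hx => exact (map_neg F (ofTerm x)).symm ▸ S.neg_mem hx
  | smul c x hx => exact (map_smul F c (ofTerm x)).symm ▸ SMulMemClass.smul_mem c hx
  | mul x y hx hy => exact (map_mul F (ofTerm x) (ofTerm y)).symm ▸ S.mul_mem hx hy
  | star x hx => exact (map_star F (ofTerm x)).symm ▸ star_mem hx

namespace SpectralNet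

variable {N : GradedNet.{u, v} K} (S : SpectralNet.{u, v, w} N)

theorem U_refl (o : K) (x : S.H o) : S.U (le_refl o) x = x :=
  (S.U (le_refl o)).injective (S.U_comp le_rfl le_rfl x).symm

/-- The support of a 1-simplex may be enlarged when computing its unitary. -/
theorem simplexU_eq {a o s : K} (b : Simplex1 a o) (h : b.supp ≤ s) (x : S.H a) :
    S.simplexU b x = (S.U (b.le_right.trans h)).symm (S.U (b.le_left.trans h) x) := by
  rw [LinearIsometryEquiv.eq_symm_apply, S.U_comp b.le_right h, S.U_comp b.le_left h]
  simp [simplexU]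

theorem simplexU_ofLE {o o' : K} (h : o ≤ o') (x : S.H o) :
    S.simplexU (.ofLE h) x = S.U h x := by
  change (S.U (le_refl o')).symm (S.U h x) = _
  rw [LinearIsometryEquiv.symm_apply_eq, U_refl]

theorem pathU_comp {x y z : K} (q : PosetPath y z) (p : PosetPath x y) (v : S.H x) :
    S.pathU (q.comp p) v = S.pathU q (S.pathU p v) := by
  induction q with
  | single b => rfl
  | step b q ih =>
    simp only [PosetPath.comp, pathU, LinearIsometryEquiv.trans_apply, ih]

theorem pathU_triv (o : K) (v : S.H o) : S.pathU (.triv o) v = v :=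
  (S.simplexU_ofLE _ v).trans (S.U_refl o v)

/-- The unitary of a path only depends on its homotopy class. -/
theorem pathU_homotopic {x y : K} {p q : PosetPath x y} (h : p.Homotopic q) :
    S.pathU p = S.pathU q := by
  induction h with
  | deform b₂ b₀ b₁ s h₀ h₁ h₂ =>
    ext v
    simp only [pathU, LinearIsometryEquiv.trans_apply, S.simplexU_eq _ h₀, S.simplexU_eq _ h₁,
      S.simplexU_eq _ h₂, LinearIsometryEquiv.apply_symm_apply]
  | comp _ _ ih₁ ih₂ =>
    ext v
    rw [pathU_comp, pathU_comp, ih₁, ih₂]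
  | refl p => rfl
  | symm _ ih => exact ih.symm
  | trans _ _ ih₁ ih₂ => exact ih₁.trans ih₂

theorem pathU_opp_apply {x y : K} (p : PosetPath x y) (v : S.H y) :
    S.pathU p.opp v = (S.pathU p).symm v := by
  obtain ⟨w, rfl⟩ := (S.pathU p).surjective v
  rw [← pathU_comp, S.pathU_homotopic (PosetPath.opp_comp_self p), pathU_triv,
    LinearIsometryEquiv.symm_apply_apply]

/-- A property of unitaries between the fibres of a net that holds for the unitaries of the
inclusions and is stable under composition and inversion holds for the unitaries of all paths. -/
theorem pathU_induction {P : ∀ {x y : K}, (S.H x ≃ₗᵢ[ℂ] S.H y) → Prop}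
    (hU : ∀ {x y : K} (h : x ≤ y), P (S.U h))
    (hsymm : ∀ {x y : K} {V : S.H x ≃ₗᵢ[ℂ] S.H y}, P V → P V.symm)
    (htrans : ∀ {x y z : K} {V : S.H x ≃ₗᵢ[ℂ] S.H y} {V' : S.H y ≃ₗᵢ[ℂ] S.H z},
      P V → P V' → P (V.trans V'))
    {x y : K} (p : PosetPath x y) : P (S.pathU p) := by
  induction p with
  | single b => exact htrans (hU _) (hsymm (hU _))
  | step b q ih => exact htrans ih (htrans (hU _) (hsymm (hU _)))

theorem pathU_Γ {x y : K} (p : PosetPath x y) (v : S.H x) :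
    S.pathU p (S.Γ x v) = S.Γ y (S.pathU p v) :=
  S.pathU_induction (P := fun {x y} V => ∀ v, V (S.Γ x v) = S.Γ y (V v))
    (fun h v => (S.Γ_U h v).symm)
    (fun h v => by rw [LinearIsometryEquiv.symm_apply_eq, h, LinearIsometryEquiv.apply_symm_apply])
    (fun h h' v => by simp [h, h']) p v

theorem pathU_D {x y : K} (p : PosetPath x y) : Conjugates (S.pathU p) (S.D x) (S.D y) :=
  S.pathU_induction (P := fun {x y} V => Conjugates V (S.D x) (S.D y))
    (fun h => S.D_U h) (fun h => h.symm) (fun h h' => h.trans h') p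

theorem Hom.V_pathU {S S' : SpectralNet.{u, v, w} N} (F : S.Hom S') {x y : K}
    (p : PosetPath x y) (v : S.H x) : F.V y (S.pathU p v) = S'.pathU p (F.V x v) := by
  have key {x y : K} (b : Simplex1 x y) (v : S.H x) :
      F.V y (S.simplexU b v) = S'.simplexU b (F.V x v) := by
    change _ = (S'.U b.le_right).symm (S'.U b.le_left (F.V x v))
    rw [LinearIsometryEquiv.eq_symm_apply, ← F.V_U, ← F.V_U]
    simp [simplexU]
  induction p with
  | single b => exact key b v
  | step b q ih => exact (key b _).trans (congrArg _ ih)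

/-! ### The holonomy triple of a net of spectral triples -/

/-- The holonomy representation `U_{*,[p]} = U_p` of the homotopy group. -/
def holonomy (a : K) : HomotopyGroup a →* (S.H a ≃ₗᵢ[ℂ] S.H a) where
  toFun := Quotient.lift (fun p => S.pathU p) fun _ _ h => S.pathU_homotopic h
  map_one' := LinearIsometryEquiv.ext (S.pathU_triv a)
  map_mul' := by
    rintro ⟨q⟩ ⟨p⟩
    exact LinearIsometryEquiv.ext (S.pathU_comp q p)

/-- The representation `t ↦ U_p π_o(t) U_p*` of `A o` on `H y` defined by a path `p : o → y`. -/
noncomputable def pathRep {o y : K} (p : PosetPath o y) : N.A o →⋆ₙₐ[ℂ] (S.H y →L[ℂ] S.H y) :=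
  (conjHom (S.pathU p)).comp (S.π o)

theorem pathRep_pathU {o y : K} (p : PosetPath o y) (t : N.A o) (x : S.H o) :
    S.pathRep p t (S.pathU p x) = S.pathU p (S.π o t x) :=
  conjHom_apply_map _ _ _

/-- The representation `π_*(p, t) = U_p π_o(t) U_p*` of the fibre. -/
noncomputable def fibreRep (a : K) : Fibre N a →⋆ₙₐ[ℂ] (S.H a →L[ℂ] S.H a) :=
  Fibre.lift (fun p => S.pathRep p)
    (fun {o o'} h p t => by
      ext x
      obtain ⟨y, rfl⟩ := (S.pathU (p.comp (.single (.ofLE h)))).surjective x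
      have e (v : S.H o) : S.pathU (p.comp (.single (.ofLE h))) v = S.pathU p (S.U h v) :=
        (S.pathU_comp _ _ v).trans (congrArg _ (S.simplexU_ofLE h v))
      rw [pathRep_pathU, e, e, pathRep_pathU, S.π_j])
    (fun h t => by rw [pathRep, pathRep, S.pathU_homotopic h])

theorem Hom.V_fibreRep {S S' : SpectralNet.{u, v, w} N} (F : S.Hom S') {a : K} (t : Fibre N a)
    (x : S.H a) : F.V a (S.fibreRep a t x) = S'.fibreRep a t (F.V a x) := by
  have h : (conjHom (F.V a)).comp (S.fibreRep a) = S'.fibreRep a := by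
    refine Fibre.hom_ext fun o p t => ContinuousLinearMap.ext fun x => ?_
    obtain ⟨y, rfl⟩ := (S'.pathU p).surjective x
    obtain ⟨z, rfl⟩ := (F.V o).surjective y
    change conjHom (F.V a) (S.pathRep p t) (S'.pathU p (F.V o z)) =
      S'.pathRep p t (S'.pathU p (F.V o z))
    rw [← F.V_pathU, conjHom_apply_map, pathRep_pathU, F.V_pathU, F.V_pathU, pathRep_pathU, F.V_π]
  rw [← h]
  exact (conjHom_apply_map _ _ _).symm

/-- The equivariant spectral triple `(H_a, Γ_a, D_a, π_*, U_*)`. -/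
noncomputable def holonomyTriple (a : K) : FibreTriple.{u, v, w} N a where
  H := S.H a
  Γ := S.Γ a
  Γ_Γ := S.Γ_Γ a
  u := S.holonomy a
  u_Γ := by
    rintro ⟨p⟩ x
    exact S.pathU_Γ p x
  π := S.fibreRep a
  π_graded t x := by
    have h : (S.fibreRep a).comp (Fibre.grading N a) = (conjHom (S.Γ a)).comp (S.fibreRep a) := by
      refine Fibre.hom_ext fun o p t => ContinuousLinearMap.ext fun x => ?_
      obtain ⟨y, rfl⟩ := (S.pathU p).surjective x
      have hs : (S.Γ a).symm (S.pathU p y) = S.pathU p (S.Γ o y) := by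
        rw [LinearIsometryEquiv.symm_apply_eq, S.pathU_Γ, S.Γ_Γ]
      change S.pathRep p (N.β o t) (S.pathU p y) =
        S.Γ a (S.pathRep p t ((S.Γ a).symm (S.pathU p y)))
      rw [hs, pathRep_pathU, pathRep_pathU, S.π_graded, S.pathU_Γ]
    have hs : (S.Γ a).symm x = S.Γ a x := by
      rw [LinearIsometryEquiv.symm_apply_eq, S.Γ_Γ]
    rw [← hs]
    exact congrArg (· x) (DFunLike.congr_fun h t)
  π_equivariant := by
    rintro ⟨g⟩ t x
    have h : (S.fibreRep a).comp (Fibre.loopAct g) =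
        (conjHom (S.pathU g)).comp (S.fibreRep a) := by
      refine Fibre.hom_ext fun o p t => ContinuousLinearMap.ext fun x => ?_
      obtain ⟨y, rfl⟩ := (S.pathU (g.comp p)).surjective x
      change S.pathRep (g.comp p) t (S.pathU (g.comp p) y) =
        conjHom (S.pathU g) (S.pathRep p t) (S.pathU (g.comp p) y)
      rw [pathRep_pathU, pathU_comp, pathU_comp, conjHom_apply_map, pathRep_pathU]
    exact (congrArg (· (S.pathU g x)) (DFunLike.congr_fun h t)).trans (conjHom_apply_map _ _ x)
  D := S.D a
  D_odd := S.D_odd a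
  D_u := by
    rintro ⟨p⟩
    exact S.pathU_D p
  π_mem := Fibre.apply_mem_of_gen (S.fibreRep a) (superDomAlgebra (S.Γ_Γ a) (S.D_odd a))
    fun o p t => conjHom_mem_superDom (S.pathU_Γ p) (S.pathU_D p) (S.π_mem o t)

/-- The functor `S ↦ (H_a, Γ_a, D_a, π_*, U_*)`, `V ↦ V_a`. -/
noncomputable def holonomyFunctor (N : GradedNet.{u, v} K) (a : K) :
    SpectralNet.{u, v, w} N ⥤ FibreTriple.{u, v, w} N a where
  obj S := S.holonomyTriple a
  map {S S'} F :=
    { V := Hom.V F a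
      V_u := by
        rintro ⟨p⟩ x
        exact Hom.V_pathU F p x
      V_Γ := Hom.V_Γ F a
      V_π := Hom.V_fibreRep F
      V_D := Hom.V_D F a }

theorem holonomyFunctor_faithful (hK : PathwiseConnected K) (a : K) :
    (holonomyFunctor.{u, v, w} N a).Faithful where
  map_injective {S S' F G} h := by
    have ha : Hom.V F a = Hom.V G a := congrArg EquivTriple.Hom.V h
    refine Hom.ext (funext fun o => LinearIsometryEquiv.ext fun x => ?_)
    obtain ⟨p⟩ := hK o a
    apply (S'.pathU p).injective
    rw [← Hom.V_pathU, ← Hom.V_pathU, ha]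

/-- An arrow `V` between the triples over `a` extends to the net by `V_o = U'_p* V U_p`, for any
path `p : o → a`; equivariance makes this independent of `p`. -/
theorem holonomyFunctor_full (hK : PathwiseConnected K) (a : K) :
    (holonomyFunctor.{u, v, w} N a).Full where
  map_surjective {S S'} F := by
    let V : S.H a ≃ₗᵢ[ℂ] S'.H a := EquivTriple.Hom.V F
    have V_u (p : PosetPath a a) (x : S.H a) : V (S.pathU p x) = S'.pathU p (V x) :=
      EquivTriple.Hom.V_u F (HomotopyGroup.mk p) x
    have V_Γ (x : S.H a) : V (S.Γ a x) = S'.Γ a (V x) := EquivTriple.Hom.V_Γ F x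
    have V_π {o : K} (p : PosetPath o a) (t : N.A o) (x : S.H a) :
        V (S.pathRep p t x) = S'.pathRep p t (V x) := EquivTriple.Hom.V_π F (Fibre.gen p t) x
    let p (o : K) : PosetPath o a := (hK o a).some
    let W (o : K) : S.H o ≃ₗᵢ[ℂ] S'.H o := ((S.pathU (p o)).trans V).trans (S'.pathU (p o)).symm
    have hW {o : K} (q : PosetPath o a) (x : S.H o) : S'.pathU q (W o x) = V (S.pathU q x) := by
      have h := V_u (q.comp (p o).opp) (S.pathU (p o) x)
      rw [pathU_comp, pathU_comp, pathU_opp_apply, pathU_opp_apply,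
        LinearIsometryEquiv.symm_apply_apply] at h
      exact h.symm
    refine ⟨⟨W, fun {o o'} h x => ?_, fun o x => ?_, fun o t x => ?_, fun o => ?_⟩, ?_⟩
    · apply (S'.pathU (p o')).injective
      have h₁ := hW ((p o').comp (.single (.ofLE h))) x
      rw [pathU_comp, pathU_comp] at h₁
      simp only [pathU, simplexU_ofLE] at h₁
      rw [h₁, hW]
    · apply (S'.pathU (p o)).injective
      rw [hW, pathU_Γ, V_Γ, pathU_Γ, hW]
    · apply (S'.pathU (p o)).injective
      rw [hW, ← pathRep_pathU, V_π, ← pathRep_pathU, hW]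
    · exact ((S.pathU_D (p o)).trans (EquivTriple.Hom.V_D F)).trans (S'.pathU_D (p o)).symm
    · have h : W a = V := LinearIsometryEquiv.ext fun x => by
        rw [← S'.pathU_triv a (W a x), hW, pathU_triv]
      exact EquivTriple.Hom.ext h

end SpectralNet

/-! ### The net of spectral triples of an equivariant spectral triple -/

/-- The loop class `[p_{o'} * p * p_o⁻¹]` of a path `p : o → o'`, relative to a choice of paths
`p_o : o → a`. -/
def loopClass {a : K} (c : ∀ o, PosetPath o a) {o o' : K} (p : PosetPath o o') :
    HomotopyGroup a :=
  .mk (((c o').comp p).comp (c o).opp)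

section LoopClass

variable {a : K} (c : ∀ o, PosetPath o a)

theorem loopClass_comp {x y z : K} (q : PosetPath y z) (p : PosetPath x y) :
    loopClass c (q.comp p) = loopClass c q * loopClass c p := by
  refine Quotient.sound (.symm ?_)
  change ((((c z).comp q).comp (c y).opp).comp (((c y).comp p).comp (c x).opp)).Homotopic
    (((c z).comp (q.comp p)).comp (c x).opp)
  have h : (((c y).opp.comp (c y)).comp (p.comp (c x).opp)).Homotopic (p.comp (c x).opp) :=
    ((PosetPath.opp_comp_self _).comp (.refl _)).trans (PosetPath.triv_comp _)
  simp only [PosetPath.comp_assoc] at h ⊢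
  exact (PosetPath.Homotopic.refl _).comp ((PosetPath.Homotopic.refl _).comp h)

theorem loopClass_homotopic {x y : K} {p q : PosetPath x y} (h : p.Homotopic q) :
    loopClass c p = loopClass c q :=
  Quotient.sound (((PosetPath.Homotopic.refl _).comp h).comp (.refl _))

theorem action_loopClass {N : GradedNet.{u, v} K} {o o' : K} (p : PosetPath o o') (t : N.A o) :
    Fibre.action N a (loopClass c p) (Fibre.gen (c o) t) = Fibre.gen ((c o').comp p) t := by
  refine Quotient.sound (.gen_homotopic ?_ t)
  rw [PosetPath.comp_assoc]
  exact ((PosetPath.Homotopic.refl _).comp (PosetPath.opp_comp_self _)).trans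
    (PosetPath.comp_triv _)

end LoopClass

namespace EquivTriple

section Iso

variable {G : Type u} [Group G] {A : Type v} [NonUnitalRing A] [StarRing A] [Module ℂ A]
  [IsScalarTower ℂ A A] [SMulCommClass ℂ A A] [StarModule ℂ A]
  {α : G →* (A →⋆ₙₐ[ℂ] A)} {γ : A →⋆ₙₐ[ℂ] A}

/-- Every arrow of equivariant spectral triples is invertible, with inverse `V*`. -/
def Hom.toIso {S S' : EquivTriple.{u, v, w} α γ} (F : S.Hom S') : S ≅ S' where
  hom := F
  inv :=
    { V := F.V.symm
      V_u := fun g x => by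
        rw [LinearIsometryEquiv.symm_apply_eq, F.V_u, LinearIsometryEquiv.apply_symm_apply]
      V_Γ := fun x => by
        rw [LinearIsometryEquiv.symm_apply_eq, F.V_Γ, LinearIsometryEquiv.apply_symm_apply]
      V_π := fun t x => by
        rw [LinearIsometryEquiv.symm_apply_eq, F.V_π, LinearIsometryEquiv.apply_symm_apply]
      V_D := F.V_D.symm }
  hom_inv_id := Hom.ext (LinearIsometryEquiv.ext F.V.symm_apply_apply)
  inv_hom_id := Hom.ext (LinearIsometryEquiv.ext F.V.apply_symm_apply)

end Iso

variable {N : GradedNet.{u, v} K} {a : K} (T : FibreTriple.{u, v, w} N a)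
  (c : ∀ o, PosetPath o a)

/-- The net with constant Hilbert space `H` defined by an equivariant spectral triple and a choice
of paths `p_o : o → a`: the inclusion `o ≤ o'` acts by `u` of its loop class, and `A o` acts by
`t ↦ π(p_o, t)`. -/
noncomputable def toNet : SpectralNet.{u, v, w} N where
  H _ := T.H
  U h := T.u (loopClass c (.single (.ofLE h)))
  U_comp {o o' o''} h h' x := by
    have e : loopClass c (.single (.ofLE (h.trans h'))) =
        loopClass c (.single (.ofLE h')) * loopClass c (.single (.ofLE h)) :=
      (loopClass_homotopic c (.deform _ _ _ o'' le_rfl le_rfl h')).trans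
        (loopClass_comp c (.single (.ofLE h')) (.single (.ofLE h)))
    rw [e, map_mul]
    rfl
  Γ _ := T.Γ
  Γ_Γ _ := T.Γ_Γ
  Γ_U _ x := (T.u_Γ _ x).symm
  π o := T.π.comp (Fibre.genHom (c o))
  π_j {o o'} h t x := by
    have e : Fibre.gen (c o') (N.j h t) =
        Fibre.action N a (loopClass c (.single (.ofLE h))) (Fibre.gen (c o) t) :=
      (action_loopClass c _ t).symm ▸ (Quotient.sound (FibreRel.gen_incl h (c o') t)).symm
    change T.π (Fibre.gen (c o') (N.j h t)) _ = T.u _ (T.π (Fibre.gen (c o) t) x)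
    rw [e, T.π_equivariant]
  π_graded o t x := T.π_graded (Fibre.gen (c o) t) x
  D _ := T.D
  D_odd _ := T.D_odd
  D_U _ := T.D_u _
  π_mem o t := T.π_mem _

theorem toNet_pathU {x y : K} (p : PosetPath x y) (v : T.H) :
    (T.toNet c).pathU p v = T.u (loopClass c p) v := by
  have key {x y : K} (b : Simplex1 x y) (v : T.H) :
      (T.toNet c).simplexU b v = T.u (loopClass c (.single b)) v := by
    change (T.u (loopClass c (.single (.ofLE b.le_right)))).symm
      (T.u (loopClass c (.single (.ofLE b.le_left))) v) = _
    have e : loopClass c (.single (.ofLE b.le_left)) =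
        loopClass c (.single (.ofLE b.le_right)) * loopClass c (.single b) :=
      (loopClass_homotopic c (.deform b (.ofLE b.le_right) _ b.supp le_rfl le_rfl le_rfl)).trans
        (loopClass_comp c (.single (.ofLE b.le_right)) (.single b))
    rw [LinearIsometryEquiv.symm_apply_eq, e, map_mul]
    rfl
  induction p with
  | single b => exact key b v
  | step b q ih =>
    have e : loopClass c (.step b q) = loopClass c (.single b) * loopClass c q :=
      loopClass_comp c (.single b) q
    rw [e, map_mul]
    exact (key b _).trans (congrArg _ ih)

theorem conjHom_u (g : HomotopyGroup a) (t : Fibre N a) :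
    conjHom (T.u g) (T.π t) = T.π (Fibre.action N a g t) := by
  ext x
  obtain ⟨y, rfl⟩ := (T.u g).surjective x
  rw [conjHom_apply_map, T.π_equivariant]

theorem toNet_fibreRep (t : Fibre N a) (x : T.H) :
    (T.toNet c).fibreRep a t (T.u (.mk (c a)) x) = T.u (.mk (c a)) (T.π t x) := by
  have h : (conjHom (T.u (.mk (c a)))).comp T.π = (T.toNet c).fibreRep a := by
    refine Fibre.hom_ext fun o p t => ?_
    let V : T.H ≃ₗᵢ[ℂ] T.H := (T.toNet c).pathU p
    have e : V = T.u (loopClass c p) := LinearIsometryEquiv.ext (T.toNet_pathU c p)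
    have h' : conjHom (T.u (.mk (c a))) (T.π (Fibre.gen p t)) =
        conjHom V (T.π (Fibre.gen (c o) t)) := by
      rw [e, conjHom_u, conjHom_u, action_loopClass]
      rfl
    exact h'
  exact (congrArg (· (T.u (.mk (c a)) x)) (DFunLike.congr_fun h t)).symm.trans
    (conjHom_apply_map _ _ _)

/-- The unitary `u [p_a]` identifies an equivariant spectral triple with the holonomy triple of
its net. -/
noncomputable def toNetIso : T ≅ (T.toNet c).holonomyTriple a :=
  Hom.toIso
    { V := T.u (.mk (c a))
      V_u := by
        rintro ⟨p⟩ x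
        refine Eq.trans ?_ (T.toNet_pathU c p _).symm
        have e : loopClass c p * .mk (c a) = .mk (c a) * .mk p := by
          refine Quotient.sound ?_
          change ((((c a).comp p).comp (c a).opp).comp (c a)).Homotopic ((c a).comp p)
          rw [PosetPath.comp_assoc]
          exact ((PosetPath.Homotopic.refl _).comp (PosetPath.opp_comp_self _)).trans
            (PosetPath.comp_triv _)
        have h := congrArg (T.u · x) e
        simp only [map_mul] at h
        exact h.symm
      V_Γ := T.u_Γ _
      V_π := fun t x => (T.toNet_fibreRep c t x).symm
      V_D := T.D_u _ }

end EquivTriple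

theorem SpectralNet.holonomyFunctor_essSurj {N : GradedNet.{u, v} K} (hK : PathwiseConnected K)
    (a : K) : (SpectralNet.holonomyFunctor.{u, v, w} N a).EssSurj where
  mem_essImage T := ⟨_, ⟨(T.toNetIso fun o => (hK o a).some).symm⟩⟩

theorem SpectralNet.isHolonomyTriple_holonomyTriple {N : GradedNet.{u, v} K}
    (S : SpectralNet.{u, v, w} N) (a : K) :
    IsHolonomyTriple S (S.holonomyTriple a) (LinearIsometryEquiv.refl ℂ (S.H a)) where
  grading _ := rfl
  dirac _ _ := Iff.rfl
  rep _ p t x := S.pathRep_pathU p t x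
  unitary _ _ := rfl

end Paths

end NetSpectral

theorem theorem4p4 {K : Type u} [PartialOrder K]
    (hK : NetSpectral.PathwiseConnected K) (a : K) (N : NetSpectral.GradedNet.{u, v} K) :
    ∃ (E : NetSpectral.SpectralNet.{u, v, w} N ≌ NetSpectral.FibreTriple.{u, v, w} N a)
      (W : ∀ S : NetSpectral.SpectralNet.{u, v, w} N, S.H a ≃ₗᵢ[ℂ] (E.functor.obj S).H),
      (∀ S, NetSpectral.IsHolonomyTriple S (E.functor.obj S) (W S)) ∧
      ∀ (S S' : NetSpectral.SpectralNet.{u, v, w} N) (F : S ⟶ S') (x : S.H a),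
        NetSpectral.EquivTriple.Hom.V (E.functor.map F) (W S x) =
          W S' (NetSpectral.SpectralNet.Hom.V F a x) := by

  have := NetSpectral.SpectralNet.holonomyFunctor_faithful.{u, v, w} (N := N) hK a
  have := NetSpectral.SpectralNet.holonomyFunctor_full.{u, v, w} (N := N) hK a
  have := NetSpectral.SpectralNet.holonomyFunctor_essSurj.{u, v, w} (N := N) hK a
  have : (NetSpectral.SpectralNet.holonomyFunctor.{u, v, w} N a).IsEquivalence := { }
  exact ⟨(NetSpectral.SpectralNet.holonomyFunctor.{u, v, w} N a).asEquivalence,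
    fun S => LinearIsometryEquiv.refl ℂ (S.H a),
    fun S => S.isHolonomyTriple_holonomyTriple a, fun _ _ _ _ => rfl⟩
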